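/- Let $\mathcal M_d$ denote the complex $d\times d$ matrices and let $\Phi:\mathcal M_d\to\mathcal M_{d_{\rm out}}$ be a quantum channel, i.e. a completely positive, trace preserving linear map. A channel $\Phi_c:\mathcal M_d\to\mathcal M_{d_{\rm env}}$ is *complementary* to $\Phi$ if there is an isometry $V:\mathbb C^d\to\mathbb C^{d_{\rm out}}\otimes\mathbb C^{d_{\rm env}}$ with $\Phi(X)=\operatorname{Tr}_{\rm env}(VXV^\dagger)$ and $\Phi_c(X)=\operatorname{Tr}_{\rm out}(VXV^\dagger)$ for all $X\in\mathcal M_d$; here $d_{\rm env}$ is arbitrary. Let $\mathcal C_\Phi$ be the (non-empty) collection of all channels complementary to $\Phi$, and define $$d^*_{\rm env}(\Phi)=\min\{d_{\rm env}:\ \exists\,\Phi_c\in\mathcal C_\Phi,\ \Phi_c:\mathcal M_d\to\mathcal M_{d_{\rm env}}\},\qquad d^*_{\rm out}(\Phi)=d^*_{\rm env}(\Phi_c)\ \text{ for } \Phi_c\in\mathcal C_\Phi$$ (the latter does not depend on the choice of $\Phi_c$). For a channel $\Psi$ let $\mathcal Q^{(1)}(\Psi)=\max_\rho\big(S(\Psi(\rho))-S(\Psi_c(\rho))\big)$,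 where $\rho$ runs over the quantum states (positive semidefinite matrices of trace one) on the input space, $S(\rho)=-\operatorname{Tr}(\rho\log\rho)$, and $\Psi_c\in\mathcal C_\Psi$ is arbitrary (the value does not depend on it). The quantum capacity of $\Psi$ is $\mathcal Q(\Psi)=\lim_{n\to\infty}\frac1n\mathcal Q^{(1)}(\Psi^{\otimes n})$. **Theorem.** Suppose that $\Phi$ is more capable, i.e. $\mathcal Q(\Phi_c)=0$ for every $\Phi_c\in\mathcal C_\Phi$. If there exists a unit vector $\psi\in\mathbb C^d$ such that $\operatorname{rank}\Phi(|\psi\rangle\langle\psi|)=d^*_{\rm out}(\Phi)$, then $$d^*_{\rm out}(\Phi)=d^*_{\rm env}(\Phi).$$ -/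

import Mathlib

open scoped Matrix ComplexOrder

namespace QChannel

/-- Linear maps from `a × a` complex matrices to `b × b` complex matrices. -/
abbrev MatMap (a b : Type*) : Type _ := Matrix a a ℂ →ₗ[ℂ] Matrix b b ℂ

/-- Partial trace of a matrix on the tensor product `ℂ^b ⊗ ℂ^e` over the second factor. -/
def traceSnd {b e : Type*} [Fintype e] (M : Matrix (b × e) (b × e) ℂ) : Matrix b b ℂ :=
  Matrix.of fun i j => ∑ k, M (i, k) (j, k)

/-- Partial trace of a matrix on the tensor product `ℂ^b ⊗ ℂ^e` over the first factor. -/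
def traceFst {b e : Type*} [Fintype b] (M : Matrix (b × e) (b × e) ℂ) : Matrix e e ℂ :=
  Matrix.of fun i j => ∑ k, M (k, i) (k, j)

/-- `(Φ ⊗ id_k) M` for a matrix `M` on `ℂ^a ⊗ ℂ^k`: the map `Φ` is applied to each of the
`k × k` blocks of `M`. -/
def ampliation {a b : Type*} (Φ : MatMap a b) (k : ℕ)
    (M : Matrix (a × Fin k) (a × Fin k) ℂ) : Matrix (b × Fin k) (b × Fin k) ℂ :=
  Matrix.of fun x y => Φ (Matrix.of fun p q => M (p, x.2) (q, y.2)) x.1 y.1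

/-- Quantum channels: completely positive trace preserving linear maps. -/
structure IsChannel {a b : Type*} [Fintype a] [Fintype b] (Φ : MatMap a b) : Prop where
  completelyPositive : ∀ (k : ℕ) (M : Matrix (a × Fin k) (a × Fin k) ℂ),
    M.PosSemidef → (ampliation Φ k M).PosSemidef
  tracePreserving : ∀ X : Matrix a a ℂ, (Φ X).trace = X.trace

/-- Quantum states (density matrices). -/
def IsState {a : Type*} [Fintype a] (ρ : Matrix a a ℂ) : Prop :=
  ρ.PosSemidef ∧ ρ.trace = 1

/-- The maps `Φ` and `Φc` arise from one Stinespring isometry `V : ℂ^a → ℂ^b ⊗ ℂ^e` by tracing out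
the environment `ℂ^e` and the output `ℂ^b` respectively. (Both are then automatically channels.) -/
def IsComplementary {a b e : Type*} [Fintype a] [DecidableEq a] [Fintype b] [Fintype e]
    (Φ : MatMap a b) (Φc : MatMap a e) : Prop :=
  ∃ V : Matrix (b × e) a ℂ, Vᴴ * V = 1 ∧
    (∀ X, Φ X = traceSnd (V * X * Vᴴ)) ∧ (∀ X, Φc X = traceFst (V * X * Vᴴ))

/-- The minimal environment dimension: the least `e` such that some channel into the `e × e`
matrices is complementary to `Φ`. -/
noncomputable def minEnvDim {a b : Type*} [Fintype a] [DecidableEq a] [Fintype b]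
    (Φ : MatMap a b) : ℕ :=
  sInf {e : ℕ | ∃ Φc : MatMap a (Fin e), IsComplementary Φ Φc}

/-- The minimal output dimension: the minimal environment dimension of a complementary channel.
It is the same number for all complementary channels, so the set below is a singleton when `Φ` is
a channel. -/
noncomputable def minOutDim {a b : Type*} [Fintype a] [DecidableEq a] [Fintype b]
    (Φ : MatMap a b) : ℕ :=
  sInf {m : ℕ | ∃ (e : ℕ) (Φc : MatMap a (Fin e)), IsComplementary Φ Φc ∧ minEnvDim Φc = m}

/-- The von Neumann entropy `-Tr (ρ log ρ)`, with the logarithm taken by functional calculus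
(`Real.log 0 = 0` gives the usual convention `0 log 0 = 0`). -/
noncomputable def vonNeumannEntropy {a : Type*} [Fintype a] [DecidableEq a]
    (ρ : Matrix a a ℂ) : ℝ :=
  -(ρ * cfc Real.log ρ).trace.re

/-- The coherent information of the state `ρ` with respect to `Φ`, computed from a complementary
channel `Φc` (the value is the same for every complementary channel). -/
noncomputable def coherentInfoAt {a b e : Type*} [Fintype b] [DecidableEq b]
    [Fintype e] [DecidableEq e] (Φ : MatMap a b) (Φc : MatMap a e) (ρ : Matrix a a ℂ) : ℝ :=
  vonNeumannEntropy (Φ ρ) - vonNeumannEntropy (Φc ρ)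

/-- The coherent information of a channel: the maximum over all states of their coherent
information. -/
noncomputable def coherentInfo {a b : Type*} [Fintype a] [DecidableEq a]
    [Fintype b] [DecidableEq b] (Φ : MatMap a b) : ℝ :=
  sSup {x : ℝ | ∃ (e : ℕ) (Φc : MatMap a (Fin e)) (ρ : Matrix a a ℂ),
    IsComplementary Φ Φc ∧ IsState ρ ∧ x = coherentInfoAt Φ Φc ρ}

/-- The tensor power `Φ^{⊗ n}`. The tensor power `(ℂ^a)^{⊗ n}` has the standard basis
`Fin n → a`, and the matrix unit `E_{k l} = ⊗ₜ E_{k t, l t}` is sent to `⊗ₜ Φ (E_{k t, l t})`. -/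
noncomputable def tensorPow {a b : Type*} [Fintype a] [DecidableEq a] (Φ : MatMap a b) (n : ℕ) :
    MatMap (Fin n → a) (Fin n → b) where
  toFun X := Matrix.of fun i j =>
    ∑ k : Fin n → a, ∑ l : Fin n → a, X k l * ∏ t, Φ (Matrix.single (k t) (l t) 1) (i t) (j t)
  map_add' X Y := by
    ext i j
    simp [add_mul, Finset.sum_add_distrib]
  map_smul' c X := by
    ext i j
    simp [Finset.mul_sum, mul_assoc]

/-- `Φ` has quantum capacity `q`, that is, `q` is the limit of the normalized `n`-shot coherent
informations of `Φ`. -/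
def HasQuantumCapacity {a b : Type*} [Fintype a] [DecidableEq a] [Fintype b] [DecidableEq b]
    (Φ : MatMap a b) (q : ℝ) : Prop :=
  Filter.Tendsto (fun n : ℕ => coherentInfo (tensorPow Φ n) / (n : ℝ)) Filter.atTop (nhds q)

/-- A channel is more capable if every channel complementary to it has zero quantum capacity. -/
def IsMoreCapable {a b : Type*} [Fintype a] [DecidableEq a] [Fintype b]
    (Φ : MatMap a b) : Prop :=
  ∀ (e : ℕ) (Φc : MatMap a (Fin e)), IsComplementary Φ Φc → HasQuantumCapacity Φc 0

end QChannel

/-! Let `Φc` be a complement whose environment dimension is the rank of the Choi matrix of `Φ`. This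
rank is `minEnvDim Φ`, and it equals the rank of `Φc 1`, so `Φc 1` is nonsingular; dually `minOutDim
Φ` is the rank of `Φ 1`. For a pure state `π` the matrices `Φ π` and `Φc π` have the same rank and
the same entropy, because both come from one Schmidt decomposition. Under the rank hypothesis this
gives `minOutDim Φ ≤ minEnvDim Φ`, and if the inequality is strict, `Φc π` is singular while `Φ π`
has the full support of `Φ 1`.

Now mix `π` with a weight `ε` of the maximally mixed state. On the `Φ` side the perturbation stays
inside the support, so the entropy grows at most linearly in `ε`; on the `Φc` side it leaves the
support, and the entropy gains a term of order `-ε log ε`. For small `ε` the coherent information of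
`Φc` is therefore positive (`exists_vonNeumannEntropy_lt`, resting on Klein's inequality). Product
inputs keep it positive for all tensor powers after normalization
(`IsComplementary.coherentInfoAt_nonpos`), contradicting zero capacity of `Φc`. -/

namespace QChannel

/-! ### Entropy in terms of eigenvalues -/

section Spectral

variable {a : Type*} [Fintype a] [DecidableEq a] {A : Matrix a a ℂ}

/-- Spectral decomposition of a Hermitian matrix together with its functional calculus. -/
theorem exists_spectral (hA : A.IsHermitian) :
    ∃ U : Matrix a a ℂ, Uᴴ * U = 1 ∧ U * Uᴴ = 1 ∧
      A = U * Matrix.diagonal (fun i => (hA.eigenvalues i : ℂ)) * Uᴴ ∧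
      ∀ f : ℝ → ℝ,
        cfc f A = U * Matrix.diagonal (fun i => ((f (hA.eigenvalues i) : ℝ) : ℂ)) * Uᴴ := by
  refine ⟨hA.eigenvectorUnitary, ?_, ?_, ?_, fun f => ?_⟩
  · exact Unitary.coe_star_mul_self hA.eigenvectorUnitary
  · exact Unitary.coe_mul_star_self hA.eigenvectorUnitary
  · have h := hA.spectral_theorem
    rw [Unitary.conjStarAlgAut_apply] at h
    exact h
  · rw [hA.cfc_eq f, Matrix.IsHermitian.cfc, Unitary.conjStarAlgAut_apply]
    rfl

theorem vonNeumannEntropy_eq_sum_eigenvalues (hA : A.IsHermitian) :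
    vonNeumannEntropy A = ∑ i, Real.negMulLog (hA.eigenvalues i) := by
  obtain ⟨U, hU, hU', hAU, hf⟩ := exists_spectral hA
  have h : A * cfc Real.log A = U * Matrix.diagonal (fun i =>
      ((hA.eigenvalues i * Real.log (hA.eigenvalues i) : ℝ) : ℂ)) * Uᴴ := by
    rw [hf]
    nth_rewrite 1 [hAU]
    rw [show ∀ D E : Matrix a a ℂ, U * D * Uᴴ * (U * E * Uᴴ) = U * (D * (Uᴴ * U) * E) * Uᴴ by
      intros; simp only [Matrix.mul_assoc], hU, Matrix.mul_one, Matrix.diagonal_mul_diagonal]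
    simp
  rw [vonNeumannEntropy, h, Matrix.trace_mul_cycle, hU, Matrix.one_mul, Matrix.trace_diagonal,
    Complex.re_sum, ← Finset.sum_neg_distrib]
  refine Finset.sum_congr rfl fun i _ => ?_
  rw [Complex.ofReal_re, Real.negMulLog, neg_mul]

/-- In this form the entropy depends only on the characteristic polynomial, so each invariance below
reduces to an identity of characteristic polynomials. -/
theorem vonNeumannEntropy_eq_roots (hA : A.IsHermitian) :
    vonNeumannEntropy A = (A.charpoly.roots.map fun z => Real.negMulLog z.re).sum := by
  rw [vonNeumannEntropy_eq_sum_eigenvalues hA, hA.roots_charpoly_eq_eigenvalues, Multiset.map_map]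
  rfl

theorem vonNeumannEntropy_reindex {b : Type*} [Fintype b] [DecidableEq b] (e : a ≃ b)
    (hA : A.IsHermitian) : vonNeumannEntropy (Matrix.reindex e e A) = vonNeumannEntropy A := by
  have hB : (Matrix.reindex e e A).IsHermitian := hA.submatrix _
  rw [vonNeumannEntropy_eq_roots hA, vonNeumannEntropy_eq_roots hB, Matrix.charpoly_reindex]

theorem vonNeumannEntropy_transpose (hA : A.IsHermitian) :
    vonNeumannEntropy Aᵀ = vonNeumannEntropy A := by
  rw [vonNeumannEntropy_eq_roots hA, vonNeumannEntropy_eq_roots hA.transpose,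
    Matrix.charpoly_transpose]

/-- The two characteristic polynomials agree up to powers of `X`, and the extra zero roots
contribute `Real.negMulLog 0 = 0`. -/
theorem vonNeumannEntropy_mul_conjTranspose_comm {b : Type*} [Fintype b] [DecidableEq b]
    (B : Matrix a b ℂ) : vonNeumannEntropy (B * Bᴴ) = vonNeumannEntropy (Bᴴ * B) := by
  rw [vonNeumannEntropy_eq_roots (Matrix.isHermitian_mul_conjTranspose_self B),
    vonNeumannEntropy_eq_roots (Matrix.isHermitian_conjTranspose_mul_self B)]
  have h := congrArg (fun p : Polynomial ℂ => (p.roots.map fun z => Real.negMulLog z.re).sum)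
    (Matrix.charpoly_mul_comm' B Bᴴ)
  have hX : ∀ n : ℕ, (Polynomial.X ^ n : Polynomial ℂ) ≠ 0 := fun n => by simp
  simpa [Polynomial.roots_mul (mul_ne_zero (hX _) (Matrix.charpoly_monic _).ne_zero),
    Polynomial.roots_X_pow, Multiset.map_nsmul, Multiset.sum_nsmul] using h

theorem vonNeumannEntropy_unitary_conj_diagonal {U : Matrix a a ℂ} (hU : Uᴴ * U = 1) (x : a → ℝ) :
    vonNeumannEntropy (U * Matrix.diagonal (fun i => (x i : ℂ)) * Uᴴ)
      = ∑ i, Real.negMulLog (x i) := by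
  have hD : (Matrix.diagonal (fun i => (x i : ℂ))).IsHermitian :=
    Matrix.isHermitian_diagonal_of_self_adjoint _ (by
      rw [isSelfAdjoint_iff]; ext i; simp)
  have hH : (U * Matrix.diagonal (fun i => (x i : ℂ)) * Uᴴ).IsHermitian :=
    Matrix.isHermitian_mul_mul_conjTranspose U hD
  rw [vonNeumannEntropy_eq_roots hH, Matrix.charpoly_mul_comm, ← Matrix.mul_assoc, hU,
    Matrix.one_mul, Matrix.charpoly_diagonal]
  have h := Polynomial.roots_multiset_prod_X_sub_C
    (Multiset.map (fun i => (x i : ℂ)) Finset.univ.val)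
  rw [Multiset.map_map] at h
  rw [Finset.prod]
  erw [h]
  rw [Multiset.map_map]
  rfl

theorem IsState.sum_eigenvalues (hA : IsState A) : ∑ i, hA.1.1.eigenvalues i = 1 := by
  apply Complex.ofReal_injective
  rw [Complex.ofReal_sum, Complex.ofReal_one]
  exact hA.1.1.trace_eq_sum_eigenvalues.symm.trans hA.2

theorem IsState.eigenvalues_le_one (hA : IsState A) (i : a) : hA.1.1.eigenvalues i ≤ 1 := by
  rw [← hA.sum_eigenvalues]
  exact Finset.single_le_sum (fun j _ => hA.1.eigenvalues_nonneg j) (Finset.mem_univ i)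

theorem IsState.vonNeumannEntropy_nonneg (hA : IsState A) : 0 ≤ vonNeumannEntropy A := by
  rw [vonNeumannEntropy_eq_sum_eigenvalues hA.1.1]
  exact Finset.sum_nonneg fun i _ =>
    Real.negMulLog_nonneg (hA.1.eigenvalues_nonneg i) (hA.eigenvalues_le_one i)

/-- A crude bound instead of `log (card a)`; it serves only to bound the set of coherent
informations. -/
theorem IsState.vonNeumannEntropy_le_card (hA : IsState A) :
    vonNeumannEntropy A ≤ Fintype.card a := by
  rw [vonNeumannEntropy_eq_sum_eigenvalues hA.1.1]
  calc _ ≤ ∑ _i : a, (1 : ℝ) := Finset.sum_le_sum fun i _ => ?_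
    _ = _ := by simp
  have h0 := hA.1.eigenvalues_nonneg i
  have := Real.negMulLog_le_one_sub_self h0
  linarith

end Spectral

/-! ### Klein's inequality and a lower bound on cross entropy -/

section Klein

variable {a : Type*} [Fintype a] [DecidableEq a]

/-- Weighted form of `x log x - x log y ≥ x - y`. -/
theorem mul_log_sub_log_le {x y p : ℝ} (hx : 0 ≤ x) (hy : 0 ≤ y) (hp : 0 ≤ p)
    (h : y = 0 → x * p = 0) : p * (x * (Real.log y - Real.log x)) ≤ p * (y - x) := by
  rcases hx.eq_or_lt with rfl | hx
  · simpa using mul_nonneg hp hy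
  rcases hy.eq_or_lt with rfl | hy
  · have : p = 0 := by simpa [hx.ne'] using h rfl
    simp [this]
  · refine mul_le_mul_of_nonneg_left ?_ hp
    rw [← Real.log_div hy.ne' hx.ne']
    have := Real.log_le_sub_one_of_pos (div_pos hy hx)
    calc x * Real.log (y / x) ≤ x * (y / x - 1) := mul_le_mul_of_nonneg_left this hx.le
      _ = y - x := by field_simp

theorem trace_diagonal_mul_conj_diagonal (M : Matrix a a ℂ) (x y : a → ℝ) :
    (Matrix.diagonal (fun i => (x i : ℂ)) * (M * Matrix.diagonal (fun i => (y i : ℂ)) * Mᴴ)).trace.re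
      = ∑ i, ∑ j, Complex.normSq (M i j) * (x i * y j) := by
  rw [Matrix.trace, Complex.re_sum]
  refine Finset.sum_congr rfl fun i _ => ?_
  rw [Matrix.diag_apply, Matrix.diagonal_mul, Complex.re_ofReal_mul, Matrix.mul_apply,
    Complex.re_sum, Finset.mul_sum]
  refine Finset.sum_congr rfl fun j _ => ?_
  rw [Matrix.mul_diagonal, Matrix.conjTranspose_apply, mul_right_comm, RCLike.star_def,
    Complex.mul_conj, ← Complex.ofReal_mul, Complex.ofReal_re]
  ring

/-- **Klein's inequality** for positive semidefinite matrices of equal trace. -/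
theorem vonNeumannEntropy_le_neg_trace_mul_log {A B : Matrix a a ℂ} (hA : A.PosSemidef)
    (hB : B.PosSemidef) (htr : A.trace = B.trace)
    (hker : ∀ v, B *ᵥ v = 0 → A *ᵥ v = 0) :
    vonNeumannEntropy A ≤ -(A * cfc Real.log B).trace.re := by
  obtain ⟨U, hU, hU', hAU, -⟩ := exists_spectral hA.1
  obtain ⟨W, hW, hW', hBW, hf⟩ := exists_spectral hB.1
  set x := hA.1.eigenvalues with hx
  set y := hB.1.eigenvalues with hy
  set M := Uᴴ * W with hM
  have hMM : M * Mᴴ = 1 := by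
    rw [hM, Matrix.conjTranspose_mul, Matrix.conjTranspose_conjTranspose, Matrix.mul_assoc,
      ← Matrix.mul_assoc W, hW', Matrix.one_mul, hU]
  have hMM' : Mᴴ * M = 1 := by
    rw [hM, Matrix.conjTranspose_mul, Matrix.conjTranspose_conjTranspose, Matrix.mul_assoc,
      ← Matrix.mul_assoc U, hU', Matrix.one_mul, hW]
  -- The squared moduli of the entries of the unitary `M`, the overlaps of the two eigenbases, form
  -- a doubly stochastic matrix.
  have hrow : ∀ i, ∑ j, Complex.normSq (M i j) = 1 := fun i => by
    have h := congrFun (congrFun hMM i) i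
    rw [Matrix.mul_apply, Matrix.one_apply_eq] at h
    simp only [Matrix.conjTranspose_apply, RCLike.star_def, Complex.mul_conj] at h
    exact_mod_cast h
  have hcol : ∀ j, ∑ i, Complex.normSq (M i j) = 1 := fun j => by
    have h := congrFun (congrFun hMM' j) j
    rw [Matrix.mul_apply, Matrix.one_apply_eq] at h
    simp only [Matrix.conjTranspose_apply, RCLike.star_def, mul_comm (starRingEnd ℂ _),
      Complex.mul_conj] at h
    exact_mod_cast h
  have htrace : (A * cfc Real.log B).trace.re
      = ∑ i, ∑ j, Complex.normSq (M i j) * (x i * Real.log (y j)) := by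
    rw [← trace_diagonal_mul_conj_diagonal, hf]
    nth_rewrite 1 [hAU]
    rw [Matrix.mul_assoc, Matrix.mul_assoc, Matrix.trace_mul_comm, hM]
    simp only [Matrix.conjTranspose_mul, Matrix.conjTranspose_conjTranspose, Matrix.mul_assoc]
  -- Since `Real.log 0 = 0`, the scalar inequality may fail at `y j = 0`; the kernel hypothesis
  -- makes the weight or `x i` vanish there.
  have hsupp : ∀ i j, y j = 0 → x i * Complex.normSq (M i j) = 0 := fun i j hj => by
    have hBv : B *ᵥ (W.col j) = 0 := by
      have : B * W = W * Matrix.diagonal (fun i => (y i : ℂ)) := by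
        rw [hBW, Matrix.mul_assoc, hW, Matrix.mul_one]
      ext k
      have h := congrFun (congrFun this k) j
      rw [Matrix.mul_diagonal, hj] at h
      simpa [Matrix.mul_apply, Matrix.mulVec, dotProduct] using h
    have hAv := hker _ hBv
    have h1 : Matrix.diagonal (fun i => (x i : ℂ)) * M = Uᴴ * (A * W) := by
      rw [hAU, hM]
      simp only [← Matrix.mul_assoc]
      rw [hU, Matrix.one_mul]
    have h2 := congrFun (congrFun h1 i) j
    have h3 : (Uᴴ * (A * W)) i j = (Uᴴ *ᵥ (A *ᵥ W.col j)) i := by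
      simp [Matrix.mul_apply, Matrix.mulVec, dotProduct]
    rw [h3, hAv, Matrix.mulVec_zero, Matrix.diagonal_mul] at h2
    rcases mul_eq_zero.mp h2 with h | h
    · rw [Complex.ofReal_eq_zero.mp h, zero_mul]
    · rw [h, map_zero, mul_zero]
  have hsum : ∑ i, x i = ∑ j, y j := by
    have h1 := hA.1.trace_eq_sum_eigenvalues
    have h2 := hB.1.trace_eq_sum_eigenvalues
    rw [h1, h2] at htr
    exact_mod_cast htr
  have hS : vonNeumannEntropy A
      = -∑ i, ∑ j, Complex.normSq (M i j) * (x i * Real.log (x i)) := by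
    rw [vonNeumannEntropy_eq_sum_eigenvalues hA.1, ← Finset.sum_neg_distrib]
    refine Finset.sum_congr rfl fun i _ => ?_
    rw [← Finset.sum_mul, hrow, one_mul, Real.negMulLog, neg_mul]
  have hkey : ∑ i, ∑ j, Complex.normSq (M i j) * (x i * (Real.log (y j) - Real.log (x i)))
      ≤ ∑ i, ∑ j, Complex.normSq (M i j) * (y j - x i) :=
    Finset.sum_le_sum fun i _ => Finset.sum_le_sum fun j _ =>
      mul_log_sub_log_le (hA.eigenvalues_nonneg i) (hB.eigenvalues_nonneg j)
        (Complex.normSq_nonneg _) (hsupp i j)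
  have hzero : ∑ i, ∑ j, Complex.normSq (M i j) * (y j - x i) = 0 := by
    simp only [mul_sub, Finset.sum_sub_distrib]
    rw [Finset.sum_comm]
    simp only [← Finset.sum_mul, hrow, hcol, one_mul]
    linarith
  simp only [mul_sub, Finset.sum_sub_distrib] at hkey hzero
  rw [hS, htrace]
  linarith

/-- The quadratic form of a Hermitian matrix at a unit vector is a convex combination of the
eigenvalues. -/
theorem exists_weights_dotProduct_mulVec {B : Matrix a a ℂ} (hB : B.IsHermitian) {v : a → ℂ}
    (hv : star v ⬝ᵥ v = 1) : ∃ p : a → ℝ, (∀ j, 0 ≤ p j) ∧ ∑ j, p j = 1 ∧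
      (star v ⬝ᵥ B *ᵥ v).re = ∑ j, p j * hB.eigenvalues j := by
  obtain ⟨W, hW, hW', hBW, -⟩ := exists_spectral hB
  set y := hB.eigenvalues
  set u := Wᴴ *ᵥ v with hu
  refine ⟨fun j => Complex.normSq (u j), fun j => Complex.normSq_nonneg _, ?_, ?_⟩
  · have h : star u ⬝ᵥ u = 1 := by
      rw [hu, Matrix.star_mulVec, Matrix.conjTranspose_conjTranspose, Matrix.dotProduct_mulVec,
        Matrix.vecMul_vecMul, hW', Matrix.vecMul_one, hv]
    simp only [dotProduct, Pi.star_apply, RCLike.star_def, mul_comm (starRingEnd ℂ _),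
      Complex.mul_conj] at h
    exact_mod_cast h
  · have h : star v ⬝ᵥ B *ᵥ v
        = star u ⬝ᵥ Matrix.diagonal (fun i => (y i : ℂ)) *ᵥ u := by
      rw [hu, Matrix.star_mulVec, Matrix.conjTranspose_conjTranspose, ← Matrix.dotProduct_mulVec,
        Matrix.mulVec_mulVec, Matrix.mulVec_mulVec, ← hBW]
    rw [h]
    simp only [dotProduct, Matrix.mulVec_diagonal, Pi.star_apply, RCLike.star_def]
    rw [Complex.re_sum]
    refine Finset.sum_congr rfl fun j _ => ?_
    rw [mul_left_comm, mul_comm (starRingEnd ℂ _), Complex.mul_conj, ← Complex.ofReal_mul,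
      Complex.ofReal_re, mul_comm]

/-- If `T ≥ l • 1` and `B` is a positive definite state, then `-Tr (T log B)` is at least
`-l log ⟨v, B v⟩` for every unit vector `v`. -/
theorem neg_mul_log_le_neg_trace_mul_log {T B : Matrix a a ℂ} (hB : B.PosDef) (htr : B.trace = 1)
    {l : ℝ} (hl : 0 ≤ l) (hT : ∀ w : a → ℂ, star w ⬝ᵥ w = 1 → l ≤ (star w ⬝ᵥ T *ᵥ w).re)
    {v : a → ℂ} (hv : star v ⬝ᵥ v = 1) :
    -(l * Real.log (star v ⬝ᵥ B *ᵥ v).re) ≤ -(T * cfc Real.log B).trace.re := by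
  obtain ⟨W, hW, hW', hBW, hf⟩ := exists_spectral hB.1
  set y := hB.1.eigenvalues with hy
  have hst : IsState B := ⟨hB.posSemidef, htr⟩
  have hy0 : ∀ j, 0 < y j := hB.eigenvalues_pos
  have hy1 : ∀ j, y j ≤ 1 := hst.eigenvalues_le_one
  have hdiag : ∀ j, l ≤ ((Wᴴ * T * W) j j).re := fun j => by
    have h1 : star (W.col j) ⬝ᵥ W.col j = 1 := by
      have := congrFun (congrFun hW j) j
      simpa [Matrix.mul_apply, dotProduct] using this
    have h2 : star (W.col j) ⬝ᵥ T *ᵥ W.col j = (Wᴴ * T * W) j j := by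
      rw [Matrix.mul_assoc]
      simp [Matrix.mul_apply, dotProduct, Matrix.mulVec]
    rw [← h2]
    exact hT _ h1
  have htrace : (T * cfc Real.log B).trace.re = ∑ j, ((Wᴴ * T * W) j j).re * Real.log (y j) := by
    rw [hf, ← Matrix.mul_assoc, ← Matrix.mul_assoc, Matrix.trace_mul_comm, ← Matrix.mul_assoc,
      ← Matrix.mul_assoc, Matrix.trace, Complex.re_sum]
    refine Finset.sum_congr rfl fun j _ => ?_
    rw [Matrix.diag_apply, Matrix.mul_diagonal, Complex.re_mul_ofReal]
  obtain ⟨p, hp0, hu1, hu2⟩ := exists_weights_dotProduct_mulVec hB.1 hv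
  set c := (star v ⬝ᵥ B *ᵥ v).re with hc
  -- `c` is a convex combination of the eigenvalues, so they cannot all exceed it.
  obtain ⟨j, hj⟩ : ∃ j, y j ≤ c := by
    by_contra! hcon
    have h1 : ∀ j, p j * c ≤ p j * y j := fun j =>
      mul_le_mul_of_nonneg_left (hcon j).le (hp0 _)
    have h2 : ∑ j, p j * c = ∑ j, p j * y j := by
      rw [← Finset.sum_mul, hu1, one_mul, hu2]
    have h3 : ∀ j, p j = 0 := fun j => by
      have h4 := (Finset.sum_eq_sum_iff_of_le fun j _ => h1 j).mp h2 j (Finset.mem_univ j)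
      by_contra hne
      exact (hcon j).ne (mul_left_cancel₀ hne h4)
    simp [h3] at hu1
  have hlog : ∀ k, Real.log (y k) ≤ 0 := fun k => Real.log_nonpos (hy0 k).le (hy1 k)
  rw [htrace, neg_le_neg_iff]
  -- All logarithms are nonpositive because the eigenvalues of a state are at most 1, so every term
  -- except the `j`-th can be dropped.
  calc ∑ k, ((Wᴴ * T * W) k k).re * Real.log (y k) ≤ ∑ k, l * Real.log (y k) :=
        Finset.sum_le_sum fun k _ => mul_le_mul_of_nonpos_right (hdiag k) (hlog k)
    _ ≤ l * Real.log (y j) := by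
        rw [← Finset.mul_sum]
        refine mul_le_mul_of_nonneg_left ?_ hl
        rw [← Finset.add_sum_erase _ _ (Finset.mem_univ j)]
        have := Finset.sum_nonpos (s := Finset.univ.erase j) fun k _ => hlog k
        linarith
    _ ≤ l * Real.log c := mul_le_mul_of_nonneg_left (Real.log_le_log (hy0 j) hj) hl

theorem _root_.Matrix.PosDef.exists_pos_le_dotProduct_mulVec {T : Matrix a a ℂ} (hT : T.PosDef)
    [Nonempty a] :
    ∃ l : ℝ, 0 < l ∧ ∀ w : a → ℂ, star w ⬝ᵥ w = 1 → l ≤ (star w ⬝ᵥ T *ᵥ w).re := by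
  obtain ⟨i, hi⟩ := Finite.exists_min hT.1.eigenvalues
  refine ⟨_, hT.eigenvalues_pos i, fun w hw => ?_⟩
  obtain ⟨p, hp0, hp1, hp⟩ := exists_weights_dotProduct_mulVec hT.1 hw
  rw [hp, ← one_mul (hT.1.eigenvalues i), ← hp1, Finset.sum_mul]
  exact Finset.sum_le_sum fun j _ => mul_le_mul_of_nonneg_left (hi j) (hp0 j)

end Klein

/-! ### Partial traces -/

section PartialTrace

variable {a b e : Type*}

theorem traceSnd_conj_apply [Fintype a] [Fintype e] (V : Matrix (b × e) a ℂ) (X : Matrix a a ℂ)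
    (i j : b) :
    traceSnd (V * X * Vᴴ) i j = ∑ p, ∑ q, X p q * ∑ k, V (i, k) p * star (V (j, k) q) := by
  simp only [traceSnd, Matrix.of_apply, Matrix.mul_apply, Matrix.conjTranspose_apply,
    Finset.sum_mul, Finset.mul_sum]
  rw [Finset.sum_comm, Finset.sum_congr rfl fun q _ => Finset.sum_comm, Finset.sum_comm]
  exact Finset.sum_congr rfl fun p _ => Finset.sum_congr rfl fun q _ =>
    Finset.sum_congr rfl fun k _ => by ring

theorem traceFst_conj_apply [Fintype a] [Fintype b] (V : Matrix (b × e) a ℂ) (X : Matrix a a ℂ)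
    (i j : e) :
    traceFst (V * X * Vᴴ) i j = ∑ p, ∑ q, X p q * ∑ k, V (k, i) p * star (V (k, j) q) :=
  traceSnd_conj_apply (V.submatrix Prod.swap id) X i j

theorem posSemidef_traceSnd [Fintype e] {M : Matrix (b × e) (b × e) ℂ} (hM : M.PosSemidef) :
    (traceSnd M).PosSemidef := by
  have : traceSnd M = ∑ k, M.submatrix (fun i => (i, k)) (fun i => (i, k)) := by
    ext i j
    simp [traceSnd, Matrix.sum_apply]
  rw [this]
  exact Matrix.posSemidef_sum _ fun k _ => hM.submatrix _

theorem trace_traceSnd [Fintype b] [Fintype e] (M : Matrix (b × e) (b × e) ℂ) :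
    (traceSnd M).trace = M.trace := by
  simp [Matrix.trace, traceSnd, Fintype.sum_prod_type]

end PartialTrace

/-! ### Choi matrices, Stinespring dilations and minimal dimensions -/

section Stinespring

variable {a b e : Type*} [Fintype a] [DecidableEq a] [Fintype e]

/-- The Choi matrix of a linear map between matrix spaces. -/
def choi (Φ : MatMap a b) : Matrix (b × a) (b × a) ℂ :=
  Matrix.of fun x y => Φ (Matrix.single x.2 y.2 1) x.1 y.1

theorem apply_eq_sum_choi (Φ : MatMap a b) (X : Matrix a a ℂ) (i j : b) :
    Φ X i j = ∑ p, ∑ q, X p q * choi Φ (i, p) (j, q) := by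
  conv_lhs => rw [Matrix.matrix_eq_sum_single X]
  simp only [map_sum, Matrix.sum_apply]
  refine Finset.sum_congr rfl fun p _ => Finset.sum_congr rfl fun q _ => ?_
  rw [show Matrix.single p q (X p q) = X p q • Matrix.single p q (1 : ℂ) by simp, map_smul]
  rfl

theorem choi_apply_of_stinespring {Φ : MatMap a b} {V : Matrix (b × e) a ℂ}
    (h : ∀ X, Φ X = traceSnd (V * X * Vᴴ)) (i j : b) (p q : a) :
    choi Φ (i, p) (j, q) = ∑ k, V (i, k) p * star (V (j, k) q) := by
  simp only [choi, Matrix.of_apply]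
  rw [h, traceSnd_conj_apply, Finset.sum_eq_single p, Finset.sum_eq_single q]
  · simp
  · intro q' _ hq; simp [hq.symm]
  · simp
  · intro p' _ hp; simp [hp.symm]
  · simp

theorem eq_traceSnd_of_choi {Φ : MatMap a b} {V : Matrix (b × e) a ℂ}
    (h : ∀ i j p q, choi Φ (i, p) (j, q) = ∑ k, V (i, k) p * star (V (j, k) q))
    (X : Matrix a a ℂ) : Φ X = traceSnd (V * X * Vᴴ) := by
  ext i j
  rw [apply_eq_sum_choi, traceSnd_conj_apply]
  simp only [h]

variable [Fintype b]

/-- The same isometry works after swapping the two tensor factors. -/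
theorem IsComplementary.symm {Φ : MatMap a b} {Φc : MatMap a e} (h : IsComplementary Φ Φc) :
    IsComplementary Φc Φ := by
  obtain ⟨V, hV, h1, h2⟩ := h
  refine ⟨V.submatrix Prod.swap id, ?_, fun X => ?_, fun X => ?_⟩
  · rw [← hV]
    ext p q
    simp only [Matrix.mul_apply, Matrix.conjTranspose_apply, Matrix.submatrix_apply, id]
    exact Fintype.sum_equiv (Equiv.prodComm e b) _ _ fun _ => rfl
  · rw [h2]; rfl
  · rw [h1]; rfl

theorem IsComplementary.posSemidef_apply {Φ : MatMap a b} {Φc : MatMap a e}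
    (h : IsComplementary Φ Φc) {X : Matrix a a ℂ} (hX : X.PosSemidef) : (Φ X).PosSemidef := by
  obtain ⟨V, -, h1, -⟩ := h
  rw [h1]
  exact posSemidef_traceSnd (hX.mul_mul_conjTranspose_same V)

theorem IsComplementary.trace_apply {Φ : MatMap a b} {Φc : MatMap a e}
    (h : IsComplementary Φ Φc) (X : Matrix a a ℂ) : (Φ X).trace = X.trace := by
  obtain ⟨V, hV, h1, -⟩ := h
  rw [h1, trace_traceSnd, Matrix.trace_mul_cycle, hV, Matrix.one_mul]

theorem IsComplementary.isState_apply {Φ : MatMap a b} {Φc : MatMap a e}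
    (h : IsComplementary Φ Φc) {ρ : Matrix a a ℂ} (hρ : IsState ρ) : IsState (Φ ρ) :=
  ⟨h.posSemidef_apply hρ.1, (h.trace_apply ρ).trans hρ.2⟩

theorem IsComplementary.posSemidef_choi {Φ : MatMap a b} {Φc : MatMap a e}
    (h : IsComplementary Φ Φc) : (choi Φ).PosSemidef := by
  obtain ⟨V, -, h1, -⟩ := h
  have : choi Φ = (Matrix.of fun (x : b × a) (k : e) => V (x.1, k) x.2)
      * (Matrix.of fun (x : b × a) (k : e) => V (x.1, k) x.2)ᴴ := by
    ext ⟨i, p⟩ ⟨j, q⟩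
    rw [choi_apply_of_stinespring h1]
    simp [Matrix.mul_apply]
  rw [this]
  exact Matrix.posSemidef_self_mul_conjTranspose _

/-- The rank of the Choi matrix is the rank of the support of any complementary channel. -/
theorem IsComplementary.rank_choi {Φ : MatMap a b} {Φc : MatMap a e}
    (h : IsComplementary Φ Φc) : (choi Φ).rank = (Φc 1).rank := by
  obtain ⟨V, -, h1, h2⟩ := h
  set G : Matrix (b × a) e ℂ := Matrix.of fun x k => V (x.1, k) x.2 with hG
  have hc : choi Φ = G * Gᴴ := by
    ext ⟨i, p⟩ ⟨j, q⟩
    rw [choi_apply_of_stinespring h1]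
    simp [Matrix.mul_apply, hG]
  have he : Φc 1 = (Gᴴ * G)ᵀ := by
    ext k l
    rw [h2, traceFst_conj_apply]
    simp only [Matrix.one_apply, ite_mul, one_mul, zero_mul, Finset.sum_ite_eq, Finset.mem_univ,
      if_true]
    rw [Finset.sum_comm]
    simp [Matrix.mul_apply, hG, Fintype.sum_prod_type, mul_comm]
  rw [hc, he, Matrix.rank_self_mul_conjTranspose, Matrix.rank_transpose,
    Matrix.rank_conjTranspose_mul_self]

/-- Columns of `G` are eigenvectors scaled by square roots of eigenvalues; discarding the zero
eigenvalues brings the width down to the rank, which makes the dilation below minimal. -/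
theorem exists_conjTranspose_mul_eq_of_posSemidef {n : Type*} [Fintype n] [DecidableEq n]
    {C : Matrix n n ℂ} (hC : C.PosSemidef) : ∃ G : Matrix n (Fin C.rank) ℂ, C = G * Gᴴ := by
  obtain ⟨U, -, -, hCU, -⟩ := exists_spectral hC.1
  set x := hC.1.eigenvalues with hx
  have hcard : Fintype.card {i // x i ≠ 0} = C.rank := hC.1.rank_eq_card_non_zero_eigs.symm
  let ε : Fin C.rank ≃ {i // x i ≠ 0} := (Fintype.equivFinOfCardEq hcard).symm
  refine ⟨Matrix.of fun i k => U i (ε k) * (Real.sqrt (x (ε k)) : ℂ), ?_⟩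
  ext i j
  have h1 : C i j = ∑ k, x k * (U i k * star (U j k)) := by
    conv_lhs => rw [hCU]
    rw [Matrix.mul_apply]
    refine Finset.sum_congr rfl fun k _ => ?_
    rw [Matrix.mul_diagonal, Matrix.conjTranspose_apply]
    ring
  have h2 : ∀ k, (Real.sqrt (x k) : ℂ) * (Real.sqrt (x k) : ℂ) = x k := fun k => by
    rw [← Complex.ofReal_mul, Real.mul_self_sqrt (hC.eigenvalues_nonneg k)]
  have h3 : ∑ k, x k * (U i k * star (U j k))
      = ∑ k : {k // x k ≠ 0}, x k * (U i k * star (U j k)) := by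
    rw [← Finset.sum_filter_of_ne (p := fun k => x k ≠ 0) fun k _ hk h0 => by simp [h0] at hk]
    exact Finset.sum_subtype _ (by simp) _
  rw [h1, h3, Matrix.mul_apply]
  refine (Fintype.sum_equiv ε _ _ fun k => ?_).symm
  simp only [Matrix.of_apply, Matrix.conjTranspose_apply, star_mul', RCLike.star_def,
    Complex.conj_ofReal]
  rw [← h2]
  ring

/-- **Stinespring dilation** with an environment of the dimension given by the rank of the Choi
matrix. -/
theorem exists_isComplementary_rank_choi {Φ : MatMap a b} [DecidableEq b]
    (hpos : (choi Φ).PosSemidef) (htr : ∀ X, (Φ X).trace = X.trace) :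
    ∃ Φc : MatMap a (Fin (choi Φ).rank), IsComplementary Φ Φc := by
  obtain ⟨G, hG⟩ := exists_conjTranspose_mul_eq_of_posSemidef hpos
  set V : Matrix (b × Fin (choi Φ).rank) a ℂ := Matrix.of fun x p => G (x.1, p) x.2 with hV
  have hch : ∀ i j p q, choi Φ (i, p) (j, q) = ∑ k, V (i, k) p * star (V (j, k) q) := by
    intro i j p q
    rw [congrFun (congrFun hG (i, p)) (j, q), Matrix.mul_apply]
    rfl
  refine ⟨{ toFun := fun X => traceFst (V * X * Vᴴ), map_add' := ?_, map_smul' := ?_ }, V, ?_,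
    eq_traceSnd_of_choi hch, fun X => rfl⟩
  · intro X Y
    ext i j
    simp [traceFst, Matrix.mul_add, Matrix.add_mul, Finset.sum_add_distrib]
  · intro c X
    ext i j
    simp [traceFst, Finset.mul_sum]
  · ext p q
    -- The `(p, q)` entry of `Vᴴ * V` is the trace of the image of this matrix unit, so trace
    -- preservation is exactly the isometry condition.
    have h := htr (Matrix.single q p 1)
    rw [Matrix.trace, Finset.sum_congr rfl fun i _ => show (Φ (Matrix.single q p 1)).diag i = _
      from hch i i q p] at h
    rw [Matrix.mul_apply, Fintype.sum_prod_type]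
    simp only [Matrix.conjTranspose_apply, mul_comm (star _)]
    rw [h, Matrix.one_apply]
    split_ifs with hpq
    · rw [hpq, Matrix.trace_single_eq_same]
    · rw [Matrix.trace_single_eq_of_ne _ _ _ (Ne.symm hpq)]

/-- The dilation above attains the rank; no smaller environment can, since that rank is also the
rank of `Φc 1`, a matrix of environment size. -/
theorem minEnvDim_eq_rank_choi {Φ : MatMap a b} [DecidableEq b]
    (hpos : (choi Φ).PosSemidef) (htr : ∀ X, (Φ X).trace = X.trace) :
    minEnvDim Φ = (choi Φ).rank := by
  have hmem := exists_isComplementary_rank_choi hpos htr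
  refine le_antisymm (Nat.sInf_le hmem) (le_csInf ⟨_, hmem⟩ ?_)
  rintro m ⟨Φc, hc⟩
  rw [hc.rank_choi]
  simpa using Matrix.rank_le_card_width (Φc 1)

theorem IsChannel.posSemidef_choi {Φ : MatMap a b} (hΦ : IsChannel Φ) :
    (choi Φ).PosSemidef := by
  let ε := Fintype.equivFin a
  -- The unnormalized maximally entangled vector: the ampliation sends its projector to the Choi
  -- matrix.
  let ω : a × Fin (Fintype.card a) → ℂ := fun x => if ε x.1 = x.2 then 1 else 0
  have h := (hΦ.completelyPositive _ _ (Matrix.posSemidef_vecMulVec_self_star ω)).submatrix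
    fun x : b × a => (x.1, ε x.2)
  convert h using 1
  ext ⟨i, p⟩ ⟨j, q⟩
  simp only [choi, ampliation, Matrix.of_apply, Matrix.submatrix_apply]
  rw [show Matrix.single p q (1 : ℂ) = Matrix.of fun r s =>
      Matrix.vecMulVec ω (star ω) (r, ε p) (s, ε q) by
    ext r s
    simp only [ω, Matrix.single_apply, Matrix.vecMulVec_apply, Matrix.of_apply, Pi.star_apply,
      EmbeddingLike.apply_eq_iff_eq, eq_comm (a := p), eq_comm (a := q)]
    split_ifs <;> simp_all]

/-- For a complement `Φc`, the minimal environment is the Choi rank of `Φc`, and by symmetry of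
complementarity this is the rank of `Φ 1`. -/
theorem minOutDim_eq_rank {Φ : MatMap a b} [DecidableEq b] (hΦ : IsChannel Φ) :
    minOutDim Φ = (Φ 1).rank := by
  have hval : ∀ (e : ℕ) (Φc : MatMap a (Fin e)), IsComplementary Φ Φc →
      minEnvDim Φc = (Φ 1).rank := fun e Φc h => by
    rw [minEnvDim_eq_rank_choi h.symm.posSemidef_choi h.symm.trace_apply, h.symm.rank_choi]
  obtain ⟨Φc, hc⟩ := exists_isComplementary_rank_choi hΦ.posSemidef_choi hΦ.tracePreserving
  have hset : {m : ℕ | ∃ (e : ℕ) (Φc : MatMap a (Fin e)), IsComplementary Φ Φc ∧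
      minEnvDim Φc = m} = {(Φ 1).rank} := by
    ext m
    constructor
    · rintro ⟨e, Φc, h, rfl⟩
      exact hval e Φc h
    · rintro rfl
      exact ⟨_, Φc, hc, hval _ Φc hc⟩
  rw [minOutDim, hset, csInf_singleton]

/-- A pure input state is sent to `A Aᴴ` and `(Aᴴ A)ᵀ` by a channel and its complement. -/
theorem IsComplementary.exists_apply_pure {Φ : MatMap a b} {Φc : MatMap a e}
    (h : IsComplementary Φ Φc) (ψ : a → ℂ) : ∃ A : Matrix b e ℂ,
      Φ (Matrix.vecMulVec ψ (star ψ)) = A * Aᴴ ∧ Φc (Matrix.vecMulVec ψ (star ψ)) = (Aᴴ * A)ᵀ := by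
  obtain ⟨V, -, h1, h2⟩ := h
  have hV : V * Matrix.vecMulVec ψ (star ψ) * Vᴴ = Matrix.vecMulVec (V *ᵥ ψ) (star (V *ᵥ ψ)) := by
    rw [Matrix.mul_vecMulVec, Matrix.vecMulVec_mul, Matrix.star_mulVec]
  refine ⟨Matrix.of fun i k => (V *ᵥ ψ) (i, k), ?_, ?_⟩
  · rw [h1, hV]
    ext i j
    simp [traceSnd, Matrix.vecMulVec_apply, Matrix.mul_apply]
  · rw [h2, hV]
    ext i j
    simp [traceFst, Matrix.vecMulVec_apply, Matrix.mul_apply, mul_comm]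

theorem IsComplementary.rank_apply_pure {Φ : MatMap a b} {Φc : MatMap a e}
    (h : IsComplementary Φ Φc) (ψ : a → ℂ) :
    (Φ (Matrix.vecMulVec ψ (star ψ))).rank = (Φc (Matrix.vecMulVec ψ (star ψ))).rank := by
  obtain ⟨A, h1, h2⟩ := h.exists_apply_pure ψ
  rw [h1, h2, Matrix.rank_transpose, Matrix.rank_self_mul_conjTranspose,
    Matrix.rank_conjTranspose_mul_self]

theorem IsComplementary.vonNeumannEntropy_apply_pure [DecidableEq b] [DecidableEq e]
    {Φ : MatMap a b} {Φc : MatMap a e} (h : IsComplementary Φ Φc) (ψ : a → ℂ) :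
    vonNeumannEntropy (Φ (Matrix.vecMulVec ψ (star ψ)))
      = vonNeumannEntropy (Φc (Matrix.vecMulVec ψ (star ψ))) := by
  obtain ⟨A, h1, h2⟩ := h.exists_apply_pure ψ
  rw [h1, h2, vonNeumannEntropy_transpose (Matrix.isHermitian_conjTranspose_mul_self A),
    vonNeumannEntropy_mul_conjTranspose_comm]

theorem IsComplementary.exists_reindex {Φ : MatMap a b} {Φc : MatMap a e}
    (h : IsComplementary Φ Φc) {f : Type*} [Fintype f] (ε : e ≃ f) :
    ∃ Φc' : MatMap a f, IsComplementary Φ Φc' ∧ ∀ X, Φc' X = Matrix.reindex ε ε (Φc X) := by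
  obtain ⟨V, hV, h1, h2⟩ := h
  refine ⟨(Matrix.reindexLinearEquiv ℂ ℂ ε ε).toLinearMap ∘ₗ Φc,
    ⟨V.submatrix (Prod.map id ε.symm) id, ?_, fun X => ?_, fun X => ?_⟩, fun X => rfl⟩
  · rw [← hV]
    ext p q
    simp only [Matrix.mul_apply, Matrix.conjTranspose_apply, Matrix.submatrix_apply, id]
    exact Fintype.sum_equiv ((Equiv.refl b).prodCongr ε.symm) _ _ fun _ => rfl
  · rw [h1]
    ext i j
    rw [traceSnd_conj_apply, traceSnd_conj_apply]
    refine Finset.sum_congr rfl fun p _ => Finset.sum_congr rfl fun q _ => congrArg _ ?_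
    exact Fintype.sum_equiv ε _ _ fun k => by simp
  · change Matrix.reindex ε ε (Φc X) = _
    rw [h2]
    rfl

end Stinespring

/-! ### Coherent information as a supremum -/

section CoherentInfo

variable {a b e : Type*} [Fintype a] [DecidableEq a] [Fintype b] [DecidableEq b] [Fintype e]
  [DecidableEq e]

/-- Needed because the real `sSup` is an upper bound only for sets that are bounded above. -/
theorem bddAbove_coherentInfo (Φ : MatMap a b) :
    BddAbove {x : ℝ | ∃ (e : ℕ) (Φc : MatMap a (Fin e)) (ρ : Matrix a a ℂ),
      IsComplementary Φ Φc ∧ IsState ρ ∧ x = coherentInfoAt Φ Φc ρ} := by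
  refine ⟨Fintype.card b, ?_⟩
  rintro x ⟨e, Φc, ρ, h, hρ, rfl⟩
  have h1 := (h.isState_apply hρ).vonNeumannEntropy_le_card
  have h2 := (h.symm.isState_apply hρ).vonNeumannEntropy_nonneg
  rw [coherentInfoAt]
  linarith

theorem IsComplementary.coherentInfoAt_le {Φ : MatMap a b} {Φc : MatMap a e}
    (h : IsComplementary Φ Φc) {ρ : Matrix a a ℂ} (hρ : IsState ρ) :
    coherentInfoAt Φ Φc ρ ≤ coherentInfo Φ := by
  obtain ⟨Φc', h', hX⟩ := h.exists_reindex (Fintype.equivFin e)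
  refine le_csSup (bddAbove_coherentInfo Φ) ⟨_, Φc', ρ, h', hρ, ?_⟩
  rw [coherentInfoAt, coherentInfoAt, hX,
    vonNeumannEntropy_reindex _ (h.symm.isState_apply hρ).1.1]

end CoherentInfo

/-! ### Tensor powers and additivity of entropy -/

section TensorPower

variable {a b e : Type*}

/-- The `n`-fold tensor power of a matrix, in the standard basis `Fin n → a`. -/
def matPow (A : Matrix b a ℂ) (n : ℕ) : Matrix (Fin n → b) (Fin n → a) ℂ :=
  Matrix.of fun i j => ∏ t, A (i t) (j t)

theorem sum_prod_eq_prod_sum {R : Type*} [CommSemiring R] [Fintype a] {n : ℕ}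
    (f : Fin n → a → R) : ∑ i : Fin n → a, ∏ t, f t (i t) = ∏ t, ∑ k, f t k := by
  rw [Finset.prod_univ_sum, Fintype.piFinset_univ]

theorem matPow_mul [Fintype a] (A : Matrix b a ℂ) (B : Matrix a e ℂ) (n : ℕ) :
    matPow A n * matPow B n = matPow (A * B) n := by
  ext i j
  simp only [matPow, Matrix.mul_apply, Matrix.of_apply, ← Finset.prod_mul_distrib]
  exact sum_prod_eq_prod_sum fun t k => A (i t) k * B k (j t)

theorem matPow_conjTranspose (A : Matrix b a ℂ) (n : ℕ) : (matPow A n)ᴴ = matPow Aᴴ n := by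
  ext i j
  simp [matPow]

theorem matPow_diagonal [DecidableEq a] (x : a → ℂ) (n : ℕ) :
    matPow (Matrix.diagonal x) n = Matrix.diagonal fun i => ∏ t, x (i t) := by
  ext i j
  by_cases h : i = j
  · subst h; simp [matPow]
  · rw [Matrix.diagonal_apply_ne _ h]
    obtain ⟨t, ht⟩ := Function.ne_iff.mp h
    exact Finset.prod_eq_zero (Finset.mem_univ t) (Matrix.diagonal_apply_ne _ ht)

theorem matPow_one [DecidableEq a] (n : ℕ) : matPow (1 : Matrix a a ℂ) n = 1 := by
  rw [← Matrix.diagonal_one, matPow_diagonal]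
  simp

theorem IsState.matPow [Fintype a] [DecidableEq a] {ρ : Matrix a a ℂ} (hρ : IsState ρ) (n : ℕ) :
    IsState (matPow ρ n) := by
  constructor
  · obtain ⟨G, hG⟩ := exists_conjTranspose_mul_eq_of_posSemidef hρ.1
    rw [hG, ← matPow_mul, ← matPow_conjTranspose]
    exact Matrix.posSemidef_self_mul_conjTranspose _
  · have := sum_prod_eq_prod_sum (n := n) fun _ k => ρ k k
    rw [Matrix.trace]
    refine this.trans ?_
    rw [show ∑ k, ρ k k = 1 from hρ.2, Finset.prod_const_one]

/-- Additivity of Shannon entropy for independent copies, by splitting off one coordinate. -/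
theorem sum_negMulLog_prod [Fintype a] {x : a → ℝ} (hx : ∑ i, x i = 1) (n : ℕ) :
    ∑ i : Fin n → a, Real.negMulLog (∏ t, x (i t)) = n * ∑ i, Real.negMulLog (x i) := by
  induction n with
  | zero => simp
  | succ n ih =>
    rw [← Fintype.sum_equiv (Fin.consEquiv fun _ => a)
      (fun y => Real.negMulLog (x y.1 * ∏ t, x (y.2 t))) _ fun y => by
        simp [Fin.prod_univ_succ, Fin.consEquiv], Fintype.sum_prod_type]
    have hone : ∑ i : Fin n → a, ∏ t, x (i t) = 1 := by
      rw [sum_prod_eq_prod_sum fun _ => x, hx, Finset.prod_const_one]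
    simp only [Real.negMulLog_mul, Finset.sum_add_distrib, ← Finset.sum_mul, ← Finset.mul_sum,
      hone, hx, ih]
    push_cast
    ring

theorem IsState.vonNeumannEntropy_matPow [Fintype a] [DecidableEq a] {ρ : Matrix a a ℂ}
    (hρ : IsState ρ) (n : ℕ) :
    vonNeumannEntropy (QChannel.matPow ρ n) = n * vonNeumannEntropy ρ := by
  obtain ⟨U, hU, -, hρU, -⟩ := exists_spectral hρ.1.1
  rw [vonNeumannEntropy_eq_sum_eigenvalues hρ.1.1, ← sum_negMulLog_prod hρ.sum_eigenvalues]
  have hU' : (QChannel.matPow U n)ᴴ * QChannel.matPow U n = 1 := by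
    rw [matPow_conjTranspose, matPow_mul, hU, matPow_one]
  rw [← vonNeumannEntropy_unitary_conj_diagonal hU']
  congr 1
  conv_lhs => rw [hρU]
  rw [← matPow_mul, ← matPow_mul, matPow_diagonal, matPow_conjTranspose]
  simp

theorem tensorPow_matPow [Fintype a] [DecidableEq a] (Φ : MatMap a b) (X : Matrix a a ℂ) (n : ℕ) :
    tensorPow Φ n (matPow X n) = matPow (Φ X) n := by
  ext i j
  simp only [tensorPow, LinearMap.coe_mk, AddHom.coe_mk, Matrix.of_apply, matPow]
  have h : ∏ t, Φ X (i t) (j t)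
      = ∏ t, ∑ p, ∑ q, X p q * Φ (Matrix.single p q 1) (i t) (j t) :=
    Finset.prod_congr rfl fun t _ => apply_eq_sum_choi Φ X _ _
  rw [h, ← sum_prod_eq_prod_sum fun t p => ∑ q, X p q * Φ (Matrix.single p q 1) (i t) (j t)]
  refine Finset.sum_congr rfl fun k _ => ?_
  rw [← sum_prod_eq_prod_sum fun t q => X (k t) q * Φ (Matrix.single (k t) q 1) (i t) (j t)]
  exact Finset.sum_congr rfl fun l _ => Finset.prod_mul_distrib.symm

/-- The `n`-fold tensor power of a Stinespring isometry. -/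
def stinespringPow (V : Matrix (b × e) a ℂ) (n : ℕ) :
    Matrix ((Fin n → b) × (Fin n → e)) (Fin n → a) ℂ :=
  Matrix.of fun x p => ∏ t, V (x.1 t, x.2 t) (p t)

theorem tensorPow_eq_traceSnd [Fintype a] [DecidableEq a] [Fintype e] {Φ : MatMap a b}
    {V : Matrix (b × e) a ℂ} (h : ∀ X, Φ X = traceSnd (V * X * Vᴴ)) (n : ℕ)
    (X : Matrix (Fin n → a) (Fin n → a) ℂ) :
    tensorPow Φ n X = traceSnd (stinespringPow V n * X * (stinespringPow V n)ᴴ) := by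
  ext i j
  rw [traceSnd_conj_apply]
  simp only [tensorPow, stinespringPow, LinearMap.coe_mk, AddHom.coe_mk, Matrix.of_apply]
  refine Finset.sum_congr rfl fun p _ => Finset.sum_congr rfl fun q _ => congrArg _ ?_
  simp only [star_prod, ← Finset.prod_mul_distrib]
  rw [sum_prod_eq_prod_sum fun t k => V (i t, k) (p t) * star (V (j t, k) (q t))]
  exact Finset.prod_congr rfl fun t _ => choi_apply_of_stinespring h _ _ _ _

theorem IsComplementary.tensorPow [Fintype a] [DecidableEq a] [Fintype b] [Fintype e]
    {Φ : MatMap a b} {Φc : MatMap a e} (h : IsComplementary Φ Φc) (n : ℕ) :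
    IsComplementary (tensorPow Φ n) (tensorPow Φc n) := by
  obtain ⟨V, hV, h1, h2⟩ := h
  refine ⟨stinespringPow V n, ?_, tensorPow_eq_traceSnd h1 n,
    fun X => ?_⟩
  · rw [← matPow_one, ← hV, ← matPow_mul, ← matPow_conjTranspose]
    ext p q
    simp only [Matrix.mul_apply, Matrix.conjTranspose_apply]
    exact (Fintype.sum_equiv (Equiv.arrowProdEquivProdArrow (Fin n) (fun _ => b) fun _ => e) _ _
      fun x => rfl).symm
  · exact tensorPow_eq_traceSnd (V := V.submatrix Prod.swap id) h2 n X

/-- A positive coherent information rules out zero quantum capacity. -/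
theorem IsComplementary.coherentInfoAt_nonpos [Fintype a] [DecidableEq a] [Fintype b]
    [DecidableEq b] [Fintype e] [DecidableEq e] {Φ : MatMap a b} {Φc : MatMap a e}
    (h : IsComplementary Φ Φc) (hcap : HasQuantumCapacity Φ 0) {ρ : Matrix a a ℂ}
    (hρ : IsState ρ) : coherentInfoAt Φ Φc ρ ≤ 0 := by
  -- For every `n > 0` the product input `matPow ρ n` shows that the normalized `n`-shot value is at
  -- least the one-shot value at `ρ`, so the limit is too.
  refine ge_of_tendsto hcap ?_
  filter_upwards [Filter.eventually_gt_atTop 0] with n hn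
  have hn' : (0 : ℝ) < n := by exact_mod_cast hn
  rw [le_div_iff₀ hn']
  refine le_trans (le_of_eq ?_) ((h.tensorPow n).coherentInfoAt_le (hρ.matPow n))
  rw [coherentInfoAt, coherentInfoAt, tensorPow_matPow, tensorPow_matPow,
    (h.isState_apply hρ).vonNeumannEntropy_matPow,
    (h.symm.isState_apply hρ).vonNeumannEntropy_matPow]
  ring

end TensorPower

/-! ### Entropy under small perturbations -/

section EntropyGap

variable {a b : Type*} [Fintype a] [Fintype b]

theorem IsState.convexCombination {P T : Matrix a a ℂ} (hP : IsState P) (hT : IsState T) {ε : ℝ}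
    (h0 : 0 ≤ ε) (h1 : ε ≤ 1) : IsState ((1 - ε) • P + ε • T) := by
  refine ⟨(hP.1.smul (sub_nonneg.mpr h1)).add (hT.1.smul h0), ?_⟩
  rw [Matrix.trace_add, Matrix.trace_smul, Matrix.trace_smul, hP.2, hT.2, ← add_smul]
  simp

theorem neg_trace_convexCombination_mul (A B L : Matrix a a ℂ) (ε : ℝ) :
    -(((1 - ε) • A + ε • B) * L).trace.re
      = (1 - ε) * -(A * L).trace.re + ε * -(B * L).trace.re := by
  rw [Matrix.add_mul, Matrix.smul_mul, Matrix.smul_mul, Matrix.trace_add, Matrix.trace_smul,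
    Matrix.trace_smul, Complex.add_re, Complex.smul_re, Complex.smul_re, smul_eq_mul, smul_eq_mul]
  ring

variable [DecidableEq a] [DecidableEq b]

/-- Perturbing `P` towards a positive definite state `T` produces a logarithmic singularity in the
entropy if `P` has a kernel, and perturbing `Q` inside its support produces none. -/
theorem exists_vonNeumannEntropy_lt {P T : Matrix a a ℂ} {Q R : Matrix b b ℂ} (hP : IsState P)
    (hT : IsState T) (hQ : IsState Q) (hR : IsState R)
    (hS : vonNeumannEntropy P = vonNeumannEntropy Q) (hTpos : T.PosDef) {v : a → ℂ}
    (hv : star v ⬝ᵥ v = 1) (hPv : P *ᵥ v = 0) (hker : ∀ w, Q *ᵥ w = 0 → R *ᵥ w = 0) :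
    ∃ ε : ℝ, 0 ≤ ε ∧ ε ≤ 1 ∧
      vonNeumannEntropy ((1 - ε) • Q + ε • R) < vonNeumannEntropy ((1 - ε) • P + ε • T) := by
  have hv0 : v ≠ 0 := by rintro rfl; simp at hv
  have : Nonempty a := by
    obtain ⟨i, -⟩ := Function.ne_iff.mp hv0
    exact ⟨i⟩
  obtain ⟨l, hl, hTl⟩ := hTpos.exists_pos_le_dotProduct_mulVec
  set τ := (star v ⬝ᵥ T *ᵥ v).re with hτ
  have hτ0 : 0 < τ := hl.trans_le (hTl v hv)
  set K := -(R * cfc Real.log Q).trace.re with hK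
  have hlim : Filter.Tendsto (fun ε : ℝ => Real.log (ε * τ)) (nhdsWithin 0 (Set.Ioi 0))
      Filter.atBot := by
    refine Real.tendsto_log_nhdsGT_zero.comp (tendsto_nhdsWithin_iff.mpr ⟨?_, ?_⟩)
    · have : Filter.Tendsto (fun ε : ℝ => ε * τ) (nhds 0) (nhds (0 * τ)) :=
        Filter.tendsto_id.mul_const τ
      rw [zero_mul] at this
      exact this.mono_left nhdsWithin_le_nhds
    · filter_upwards [self_mem_nhdsWithin] with ε hε
      exact mul_pos hε hτ0
  -- The threshold `-(K / l)` is chosen so that `-(l * Real.log (ε * τ))` exceeds `K`.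
  obtain ⟨ε, hlog, hε0, hε1⟩ := ((hlim.eventually_lt_atBot (-(K / l))).and
    (Ioo_mem_nhdsGT (zero_lt_one' ℝ))).exists
  refine ⟨ε, hε0.le, hε1.le, ?_⟩
  have hPε := hP.convexCombination hT hε0.le hε1.le
  have hQε := hQ.convexCombination hR hε0.le hε1.le
  have hPεpos : ((1 - ε) • P + ε • T).PosDef :=
    (hTpos.smul hε0).posSemidef_add (hP.1.smul (sub_nonneg.mpr hε1.le))
  -- Klein's inequality with reference state `Q`: the cross entropy is linear in its first argument,
  -- and `K` does not depend on `ε`.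
  have hupper : vonNeumannEntropy ((1 - ε) • Q + ε • R)
      ≤ (1 - ε) * vonNeumannEntropy Q + ε * K := by
    refine (vonNeumannEntropy_le_neg_trace_mul_log hQε.1 hQ.1 (hQε.2.trans hQ.2.symm)
      fun w hw => ?_).trans (neg_trace_convexCombination_mul _ _ _ _).le
    rw [Matrix.add_mulVec, Matrix.smul_mulVec, Matrix.smul_mulVec, hw, hker w hw, smul_zero,
      smul_zero, add_zero]
  have hquad : (star v ⬝ᵥ ((1 - ε) • P + ε • T) *ᵥ v).re = ε * τ := by
    rw [Matrix.add_mulVec, Matrix.smul_mulVec, Matrix.smul_mulVec, hPv, smul_zero, zero_add,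
      dotProduct_smul, Complex.smul_re, smul_eq_mul]
  -- The entropy of the mixture is its cross entropy with itself and splits linearly. The `P` part
  -- is bounded by Klein's inequality, the `T` part by the smallness of the mixture's quadratic form
  -- at the kernel vector `v`.
  have hlower : (1 - ε) * vonNeumannEntropy P + ε * -(l * Real.log (ε * τ))
      ≤ vonNeumannEntropy ((1 - ε) • P + ε • T) := by
    rw [show vonNeumannEntropy ((1 - ε) • P + ε • T) = _ from
      neg_trace_convexCombination_mul P T _ _]
    refine add_le_add (mul_le_mul_of_nonneg_left ?_ (sub_nonneg.mpr hε1.le))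
      (mul_le_mul_of_nonneg_left ?_ hε0.le)
    · refine vonNeumannEntropy_le_neg_trace_mul_log hP.1 hPε.1 (hP.2.trans hPε.2.symm)
        fun w hw => ?_
      have hw0 : w = 0 := by
        by_contra hne
        have := hPεpos.dotProduct_mulVec_pos hne
        rw [hw, dotProduct_zero] at this
        exact this.false
      rw [hw0, Matrix.mulVec_zero]
    · rw [← hquad]
      exact neg_mul_log_le_neg_trace_mul_log hPεpos hPε.2 hl.le hTl hv
  have hgap : K < -(l * Real.log (ε * τ)) := by
    have := mul_lt_mul_of_pos_left hlog hl
    rw [mul_neg, mul_div_cancel₀ _ hl.ne'] at this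
    linarith
  have := mul_lt_mul_of_pos_left hgap hε0
  rw [hS] at hlower
  linarith

end EntropyGap

/-! ### Kernels and ranks of positive semidefinite matrices -/

section Rank

variable {a b : Type*} [Fintype a] [Fintype b]

theorem _root_.Matrix.PosSemidef.mulVec_eq_zero_of_sub {A B : Matrix a a ℂ} (hA : A.PosSemidef)
    (hBA : (B - A).PosSemidef) {v : a → ℂ} (hv : B *ᵥ v = 0) : A *ᵥ v = 0 := by
  have h1 := hA.dotProduct_mulVec_nonneg v
  have h2 := hBA.dotProduct_mulVec_nonneg v
  rw [Matrix.sub_mulVec, hv, zero_sub, dotProduct_neg] at h2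
  exact (hA.dotProduct_mulVec_zero_iff v).mp (le_antisymm (neg_nonneg.mp h2) h1)

/-- If `0 ≤ A ≤ B` have the same rank, then their kernels agree. -/
theorem _root_.Matrix.PosSemidef.mulVec_eq_zero_of_rank_eq {A B : Matrix a a ℂ}
    (hA : A.PosSemidef) (hBA : (B - A).PosSemidef) (hr : A.rank = B.rank) {v : a → ℂ}
    (hv : A *ᵥ v = 0) : B *ᵥ v = 0 := by
  have hle : LinearMap.ker B.mulVecLin ≤ LinearMap.ker A.mulVecLin := fun w hw =>
    hA.mulVec_eq_zero_of_sub hBA hw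
  have h1 := LinearMap.finrank_range_add_finrank_ker A.mulVecLin
  have h2 := LinearMap.finrank_range_add_finrank_ker B.mulVecLin
  have hr' : Module.finrank ℂ (LinearMap.range A.mulVecLin)
    = Module.finrank ℂ (LinearMap.range B.mulVecLin) := hr
  have heq := Submodule.eq_of_le_of_finrank_eq hle (by omega)
  have : v ∈ LinearMap.ker A.mulVecLin := hv
  rw [← heq] at this
  exact this

theorem exists_unit_mulVec_eq_zero_of_rank_lt {A : Matrix a a ℂ}
    (hr : A.rank < Fintype.card a) : ∃ v : a → ℂ, star v ⬝ᵥ v = 1 ∧ A *ᵥ v = 0 := by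
  have h1 := LinearMap.finrank_range_add_finrank_ker A.mulVecLin
  rw [Module.finrank_fintype_fun_eq_card] at h1
  have hr' : Module.finrank ℂ (LinearMap.range A.mulVecLin) < Fintype.card a := hr
  have hne : LinearMap.ker A.mulVecLin ≠ ⊥ := by
    intro h
    rw [h, finrank_bot] at h1
    omega
  obtain ⟨w, hw, hw0⟩ := Submodule.exists_mem_ne_zero_of_ne_bot hne
  have hpos : 0 < ∑ i, Complex.normSq (w i) := by
    obtain ⟨i, hi⟩ := Function.ne_iff.mp hw0
    exact Finset.sum_pos' (fun i _ => Complex.normSq_nonneg _)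
      ⟨i, Finset.mem_univ i, Complex.normSq_pos.mpr hi⟩
  set s := ∑ i, Complex.normSq (w i) with hs
  have hww : star w ⬝ᵥ w = (s : ℂ) := by
    simp only [dotProduct, Pi.star_apply, RCLike.star_def, mul_comm (starRingEnd ℂ _),
      Complex.mul_conj, hs, Complex.ofReal_sum]
  refine ⟨((Real.sqrt s)⁻¹ : ℝ) • w, ?_, ?_⟩
  · rw [star_smul, smul_dotProduct, dotProduct_smul, hww, star_trivial, smul_smul, ← mul_inv,
      Real.mul_self_sqrt hpos.le, Complex.real_smul, ← Complex.ofReal_mul,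
      inv_mul_cancel₀ hpos.ne', Complex.ofReal_one]
  · rw [Matrix.mulVec_smul, show A *ᵥ w = 0 from hw, smul_zero]

theorem _root_.Matrix.PosSemidef.posDef_of_rank_eq_card {A : Matrix a a ℂ}
    (hA : A.PosSemidef) (hr : A.rank = Fintype.card a) : A.PosDef :=
  by
  refine Matrix.PosDef.of_dotProduct_mulVec_pos hA.1 fun x hx =>
    (hA.dotProduct_mulVec_nonneg x).lt_of_ne' fun h0 => hx ?_
  have h1 := LinearMap.finrank_range_add_finrank_ker A.mulVecLin
  have hr' : Module.finrank ℂ (LinearMap.range A.mulVecLin) = Fintype.card a := hr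
  rw [Module.finrank_fintype_fun_eq_card, hr'] at h1
  have hker : LinearMap.ker A.mulVecLin = ⊥ := Submodule.finrank_eq_zero.mp (by omega)
  have hmem : x ∈ LinearMap.ker A.mulVecLin := (hA.dotProduct_mulVec_zero_iff x).mp h0
  rwa [hker, Submodule.mem_bot] at hmem

/-- This is an orthogonal projection `N`, hence equal to `N * Nᴴ`. -/
theorem posSemidef_one_sub_vecMulVec [DecidableEq a] {ψ : a → ℂ} (hψ : star ψ ⬝ᵥ ψ = 1) :
    (1 - Matrix.vecMulVec ψ (star ψ)).PosSemidef := by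
  set N := 1 - Matrix.vecMulVec ψ (star ψ) with hN
  have hH : Nᴴ = N := by
    rw [hN, Matrix.conjTranspose_sub, Matrix.conjTranspose_one,
      (Matrix.posSemidef_vecMulVec_self_star ψ).1]
  have hsq : N = N * Nᴴ := by
    rw [hH, hN, Matrix.sub_mul, Matrix.one_mul, Matrix.mul_sub, Matrix.mul_one,
      Matrix.vecMulVec_mul_vecMulVec, hψ, one_smul, sub_self, sub_zero]
  rw [hsq]
  exact Matrix.posSemidef_self_mul_conjTranspose N

end Rank

/-! ### Positive coherent information of the complement -/

section Main

theorem map_real_smul {a b : Type*} (Ψ : MatMap a b) (r : ℝ) (X : Matrix a a ℂ) :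
    Ψ (r • X) = r • Ψ X := by
  rw [← Complex.coe_smul, map_smul, Complex.coe_smul]


variable {a b e : Type*} [Fintype a] [DecidableEq a] [Fintype b] [DecidableEq b] [Fintype e]
  [DecidableEq e]

/-- If a complementary pair `Φ, Φc` is such that `Φc 1` has full rank and some pure state is sent
by `Φ` to a state with the full support of `Φ` but by `Φc` to a singular matrix, then `Φc` has
positive coherent information at some state. -/
theorem IsComplementary.exists_coherentInfoAt_pos {Φ : MatMap a b} {Φc : MatMap a e}
    (h : IsComplementary Φ Φc) (hfull : (Φc 1).rank = Fintype.card e) {ψ : a → ℂ}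
    (hψ : star ψ ⬝ᵥ ψ = 1) (hrank : (Φ (Matrix.vecMulVec ψ (star ψ))).rank = (Φ 1).rank)
    (hlt : (Φ 1).rank < Fintype.card e) : ∃ ρ, IsState ρ ∧ 0 < coherentInfoAt Φc Φ ρ := by
  have hne : Nonempty a := by
    by_contra hempty
    rw [not_nonempty_iff] at hempty
    simp [dotProduct] at hψ
  have hcard : (0 : ℝ) < (Fintype.card a : ℝ)⁻¹ := inv_pos.mpr (by exact_mod_cast Fintype.card_pos)
  set π : Matrix a a ℂ := Matrix.vecMulVec ψ (star ψ) with hπ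
  have hπs : IsState π := by
    refine ⟨Matrix.posSemidef_vecMulVec_self_star ψ, ?_⟩
    rw [hπ, Matrix.trace_vecMulVec, dotProduct_comm, hψ]
  -- The maximally mixed state: its images have the supports of `Φ 1` and `Φc 1`.
  set μ : Matrix a a ℂ := (Fintype.card a : ℝ)⁻¹ • 1 with hμ
  have hμs : IsState μ := by
    refine ⟨Matrix.PosSemidef.one.smul hcard.le, ?_⟩
    rw [hμ, Matrix.trace_smul, Matrix.trace_one, Complex.real_smul]
    push_cast
    exact inv_mul_cancel₀ (by exact_mod_cast Fintype.card_ne_zero)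
  have hTpos : (Φc μ).PosDef := by
    rw [hμ, map_real_smul]
    exact ((h.symm.posSemidef_apply Matrix.PosSemidef.one).posDef_of_rank_eq_card hfull).smul hcard
  obtain ⟨v, hv, hPv⟩ := exists_unit_mulVec_eq_zero_of_rank_lt (A := Φc π) (by
    rw [← h.rank_apply_pure ψ, hrank]
    exact hlt)
  have hker : ∀ w, Φ π *ᵥ w = 0 → Φ μ *ᵥ w = 0 := fun w hw => by
    have hsub : (Φ 1 - Φ π).PosSemidef := by
      rw [← map_sub]
      exact h.posSemidef_apply (posSemidef_one_sub_vecMulVec hψ)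
    rw [hμ, map_real_smul, Matrix.smul_mulVec,
      (h.posSemidef_apply hπs.1).mulVec_eq_zero_of_rank_eq hsub hrank hw, smul_zero]
  obtain ⟨ε, hε0, hε1, hlt⟩ := exists_vonNeumannEntropy_lt (h.symm.isState_apply hπs)
    (h.symm.isState_apply hμs) (h.isState_apply hπs) (h.isState_apply hμs)
    (h.vonNeumannEntropy_apply_pure ψ).symm hTpos hv hPv hker
  refine ⟨(1 - ε) • π + ε • μ, hπs.convexCombination hμs hε0 hε1, ?_⟩
  rw [coherentInfoAt, map_add, map_add, map_real_smul Φ _ π, map_real_smul Φ _ μ,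
    map_real_smul Φc _ π, map_real_smul Φc _ μ]
  exact sub_pos.mpr hlt

end Main

end QChannel

theorem theorem5p1 {d dout : ℕ} (Φ : QChannel.MatMap (Fin d) (Fin dout))
    (hΦ : QChannel.IsChannel Φ) (hmc : QChannel.IsMoreCapable Φ)
    (hpure : ∃ ψ : Fin d → ℂ, star ψ ⬝ᵥ ψ = 1 ∧
      (Φ (Matrix.vecMulVec ψ (star ψ))).rank = QChannel.minOutDim Φ) :
    QChannel.minOutDim Φ = QChannel.minEnvDim Φ := by
  obtain ⟨ψ, hψ, hrank⟩ := hpure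
  obtain ⟨Φc, h⟩ :=
    QChannel.exists_isComplementary_rank_choi hΦ.posSemidef_choi hΦ.tracePreserving
  rw [QChannel.minEnvDim_eq_rank_choi hΦ.posSemidef_choi hΦ.tracePreserving]
  have hout := QChannel.minOutDim_eq_rank hΦ
  rw [hout] at hrank ⊢
  have hfull : (Φc 1).rank = Fintype.card (Fin (QChannel.choi Φ).rank) := by
    rw [← h.rank_choi, Fintype.card_fin]
  -- The pure state's two outputs share their rank, and one of them lives on the minimal
  -- environment.
  have hle : (Φ 1).rank ≤ (QChannel.choi Φ).rank := by
    rw [← hrank, h.rank_apply_pure ψ]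
    simpa using Matrix.rank_le_card_width (Φc (Matrix.vecMulVec ψ (star ψ)))
  refine hle.eq_of_not_lt fun hlt => ?_
  obtain ⟨ρ, hρ, hpos⟩ := h.exists_coherentInfoAt_pos hfull hψ hrank (by simpa using hlt)
  exact hpos.not_ge (h.symm.coherentInfoAt_nonpos (hmc _ Φc h) hρ)
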